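/- **Theorem 1.3.** Let $p$ be a prime, let $\alpha\ge 1$ be an integer, let $l,n\in\mathbb N=\{0,1,2,\ldots\}$ and $r\in\mathbb Z$. Put $a_p=1$ if $p=2$, $a_p=2$ if $p=3$, and $a_p=3$ if $p>3$. Then $$\frac1{\lfloor n/p^{\alpha-1}\rfloor!}\sum_{k\equiv r\ (\mathrm{mod}\ p^{\alpha})}(-1)^k\binom{pn}{pk}\left(\frac{k-r}{p^{\alpha-1}}\right)^l\equiv\frac1{\lfloor n/p^{\alpha-1}\rfloor!}\sum_{k\equiv r\ (\mathrm{mod}\ p^{\alpha})}(-1)^k\binom nk\left(\frac{k-r}{p^{\alpha-1}}\right)^l\pmod{p^{a_p}},$$ where the sums run over all integers $k\equiv r\pmod{p^\alpha}$ (only $0\le k\le n$ contribute) and $0^0=1$. The congruence is in the ring $\mathbb Z_p$ of $p$-adic integers: both sides are rational numbers lying in $\mathbb Z_p$, and their difference lies in $p^{a_p}\mathbb Z_p$. -/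

import Mathlib

/-- The exponent `a_p`: it is `1` for `p = 2`, `2` for `p = 3`, and `3` for every prime `p > 3`. -/
def sunExponent (p : ℕ) : ℕ :=
  if p = 2 then 1 else if p = 3 then 2 else 3

/-- `x ≡ y (mod p ^ m)` for rational numbers `x`, `y`, as a congruence in the ring of `p`-adic
integers: both `x` and `y` are `p`-adic integers, and `p ^ m` divides their difference in `ℤ_[p]`. -/
def PadicModEq (p : ℕ) [Fact p.Prime] (m : ℕ) (x y : ℚ) : Prop :=
  ∃ u v : ℤ_[p], (u : ℚ_[p]) = (x : ℚ_[p]) ∧ (v : ℚ_[p]) = (y : ℚ_[p]) ∧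
    (p : ℤ_[p]) ^ m ∣ u - v

/-! The proof has two halves. With $q=p^{\alpha-1}$, $N=\lfloor n/q\rfloor$, the first shows that
$N!$ divides in $\mathbb Z_p$ the sum of $(-1)^k\binom nk f((k-r)/q)$ over $k\equiv r$ mod $pq$, for
every $f\in\mathbb Z_p[X]$ (`factorial_dvd_sum_choose_mul_eval`): the sum is a linear functional of
$(1-X)^n$, and $(1-X)^q$ is $1-X^q$ plus a multiple of $p$.

The second shows $\binom{pn}{pk}=\binom nk(1+p^{a_p}Q(k))$ with $Q\in\mathbb Z_p[X]$
(`exists_choose_mul_mul_eq`): expand $(1+X)^{pn}=(1+X^p+pF)^n$ in powers of $F$. The two sums then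
differ by $p^{a_p}$ times a sum of the first kind, with $f(X)=X^lQ(r+qX)$. -/

open Polynomial

/-! ### Linear functionals on polynomials and powers of $1-X$ modulo $X^p-1$ -/

section WeightedCoeffSum

variable {R : Type*} [CommRing R]

/-- The linear functional on `R[X]` that sends `X ^ k` to `φ k`. -/
noncomputable def weightedCoeffSum (φ : ℕ → R) : R[X] →ₗ[R] R :=
  Polynomial.lsum fun k => φ k • LinearMap.id

theorem weightedCoeffSum_monomial (φ : ℕ → R) (k : ℕ) (c : R) :
    weightedCoeffSum φ (monomial k c) = φ k * c := by
  simp [weightedCoeffSum, Polynomial.lsum_apply, Polynomial.sum_monomial_index]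

theorem weightedCoeffSum_eq_sum_range (φ : ℕ → R) (P : R[X]) {N : ℕ} (hN : P.natDegree < N) :
    weightedCoeffSum φ P = ∑ k ∈ Finset.range N, φ k * P.coeff k := by
  conv_lhs => rw [P.as_sum_range' N hN]
  simp [weightedCoeffSum_monomial]

theorem weightedCoeffSum_X_pow_mul (φ : ℕ → R) (t : ℕ) (P : R[X]) :
    weightedCoeffSum φ (X ^ t * P) = weightedCoeffSum (fun j => φ (j + t)) P := by
  induction P using Polynomial.induction_on' with
  | add P Q hP hQ => simp only [mul_add, map_add, hP, hQ]
  | monomial k c => rw [X_pow_mul_monomial, weightedCoeffSum_monomial, weightedCoeffSum_monomial]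

theorem weightedCoeffSum_expand (φ : ℕ → R) (q : ℕ) (P : R[X]) :
    weightedCoeffSum φ (expand R q P) = weightedCoeffSum (fun j => φ (j * q)) P := by
  induction P using Polynomial.induction_on' with
  | add P Q hP hQ => simp only [map_add, hP, hQ]
  | monomial k c => rw [expand_monomial, weightedCoeffSum_monomial, weightedCoeffSum_monomial]

theorem weightedCoeffSum_X_mul_derivative (φ : ℕ → R) (P : R[X]) :
    weightedCoeffSum φ (X * derivative P) = weightedCoeffSum (fun j => j * φ j) P := by
  induction P using Polynomial.induction_on' with
  | add P Q hP hQ => simp only [map_add, mul_add, hP, hQ]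
  | monomial k c =>
    rcases k with _ | k
    · rw [derivative_monomial, weightedCoeffSum_monomial]
      simp
    · rw [derivative_monomial, X_mul_monomial, weightedCoeffSum_monomial,
        weightedCoeffSum_monomial, Nat.add_sub_cancel]
      ring

theorem weightedCoeffSum_zero : weightedCoeffSum (fun _ => (0 : R)) = 0 := by
  ext; simp [weightedCoeffSum_monomial]

theorem weightedCoeffSum_add (φ ψ : ℕ → R) (P : R[X]) :
    weightedCoeffSum (fun j => φ j + ψ j) P = weightedCoeffSum φ P + weightedCoeffSum ψ P := by
  induction P using Polynomial.induction_on' with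
  | add P Q hP hQ => simp only [map_add, hP, hQ]; ring
  | monomial k c => simp only [weightedCoeffSum_monomial]; ring

theorem weightedCoeffSum_const_mul (a : R) (φ : ℕ → R) (P : R[X]) :
    weightedCoeffSum (fun j => a * φ j) P = a * weightedCoeffSum φ P := by
  induction P using Polynomial.induction_on' with
  | add P Q hP hQ => simp only [map_add, hP, hQ]; ring
  | monomial k c => simp only [weightedCoeffSum_monomial]; ring

theorem weightedCoeffSum_C_mul (φ : ℕ → R) (a : R) (P : R[X]) :
    weightedCoeffSum φ (C a * P) = a * weightedCoeffSum φ P := by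
  rw [← smul_eq_C_mul, map_smul, smul_eq_mul]

/-- A periodic weight factors through $R[X]/(X^p-1)$. -/
theorem weightedCoeffSum_X_pow_sub_one_mul {φ : ℕ → R} {p : ℕ} (hφ : ∀ j, φ (j + p) = φ j)
    (P : R[X]) : weightedCoeffSum φ ((X ^ p - 1) * P) = 0 := by
  rw [sub_mul, one_mul, map_sub, weightedCoeffSum_X_pow_mul]
  simp only [hφ, sub_self]

/-- In `R[X] / (X ^ p - 1)`, powers of `1 - X` are highly divisible by `p`. -/
theorem exists_one_sub_X_pow_eq {p : ℕ} (hp : p.Prime) (M : ℕ) :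
    ∃ A B : R[X], (1 - X) ^ M = C ((p : R) ^ ((M - 1) / (p - 1))) * A + (X ^ p - 1) * B := by
  -- Modulo $X^p-1$, $(1-X)^p$ is $p(1-X)$ times a polynomial. One factor $1-X$ survives, so each
  -- further $p-1$ factors yield another $p$.
  have hstep : ∀ t : ℕ, ∃ A B : R[X],
      (1 - X) ^ (1 + (p - 1) * t) = C ((p : R) ^ t) * ((1 - X) * A) + (X ^ p - 1) * B := by
    intro t
    obtain ⟨g, hg⟩ := exists_add_pow_prime_eq hp (1 - X : R[X]) X
    induction t with
    | zero => exact ⟨1, 0, by simp⟩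
    | succ t ih =>
      obtain ⟨A, B, h⟩ := ih
      refine ⟨-X * g * A, C ((p : R) ^ t) * -A + (1 - X) ^ (p - 1) * B, ?_⟩
      have h1 : (1 - X : R[X]) ^ p = (1 - X ^ p) - C (p : R) * (1 - X) * X * g := by
        rw [sub_add_cancel, one_pow] at hg
        rw [map_natCast]
        linear_combination -hg
      have h2 : (1 - X : R[X]) * (1 - X) ^ (p - 1) = (1 - X) ^ p := by
        rw [← pow_succ', Nat.sub_add_cancel hp.one_le]
      rw [show 1 + (p - 1) * (t + 1) = (1 + (p - 1) * t) + (p - 1) by ring, pow_add, h,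
        pow_succ (p : R), C_mul]
      linear_combination (C ((p : R) ^ t) * A) * h2 + (C ((p : R) ^ t) * A) * h1
  rcases M with _ | M
  · exact ⟨1, 0, by simp⟩
  · obtain ⟨A, B, h⟩ := hstep (M / (p - 1))
    refine ⟨(1 - X) * A * (1 - X) ^ (M % (p - 1)), B * (1 - X) ^ (M % (p - 1)), ?_⟩
    have hM : M + 1 = (1 + (p - 1) * (M / (p - 1))) + M % (p - 1) := by
      have := Nat.div_add_mod M (p - 1)
      omega
    rw [Nat.add_sub_cancel]
    conv_lhs => rw [hM, pow_add, h]
    ring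

end WeightedCoeffSum

/-! ### Divisibility of residue-class sums by factorials -/

section Padic

variable {p : ℕ} [Fact p.Prime]

theorem PadicInt.natCast_dvd_pow_of_padicValNat_le {m t : ℕ} (hm : m ≠ 0)
    (h : padicValNat p m ≤ t) : (m : ℤ_[p]) ∣ (p : ℤ_[p]) ^ t := by
  have hm' : (m : ℤ_[p]) ≠ 0 := by exact_mod_cast hm
  have hs := PadicInt.unitCoeff_spec hm'
  have hv : (m : ℤ_[p]).valuation = padicValNat p m := by
    have h1 := PadicInt.valuation_coe (m : ℤ_[p])
    rw [PadicInt.coe_natCast, Padic.valuation_natCast] at h1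
    exact_mod_cast h1.symm
  rw [hs, hv]
  exact ((PadicInt.unitCoeff hm').isUnit.mul_left_dvd).2 (pow_dvd_pow _ h)

/-- Legendre's formula: $(p-1)v_p(m!)$ is $m$ minus the base-$p$ digit sum, which is at least 1 for
$m>0$. -/
theorem PadicInt.factorial_dvd_pow (m : ℕ) :
    ((m.factorial : ℕ) : ℤ_[p]) ∣ (p : ℤ_[p]) ^ ((m - 1) / (p - 1)) := by
  have hp : p.Prime := Fact.out
  refine PadicInt.natCast_dvd_pow_of_padicValNat_le m.factorial_ne_zero ?_
  rcases Nat.eq_zero_or_pos m with rfl | hm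
  · simp
  have h := sub_one_mul_padicValNat_factorial (p := p) m
  have hd : 1 ≤ (p.digits m).sum := by
    by_contra hcon
    have h0 : (p.digits m).sum = 0 := by omega
    have := List.sum_eq_zero_iff.1 h0 _ (List.getLast_mem (Nat.digits_ne_nil_iff_ne_zero.2 hm.ne'))
    exact Nat.getLast_digit_ne_zero p hm.ne' this
  rw [Nat.le_div_iff_mul_le (Nat.sub_pos_of_lt hp.one_lt), mul_comm, h]
  omega

theorem PadicInt.factorial_dvd_pow_self (m : ℕ) :
    ((m.factorial : ℕ) : ℤ_[p]) ∣ (p : ℤ_[p]) ^ m :=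
  (PadicInt.factorial_dvd_pow m).trans
    (pow_dvd_pow _ ((Nat.div_le_self _ _).trans (Nat.sub_le _ _)))

/-- The divisibility for residue classes modulo `p` with weight a power of the index. -/
theorem factorial_dvd_weightedCoeffSum_pow (u : ℤ) (l M : ℕ) (P : ℤ_[p][X]) :
    ((M.factorial : ℕ) : ℤ_[p]) ∣
      weightedCoeffSum (fun j : ℕ => if (p : ℤ) ∣ j + u then (((j + u : ℤ) : ℤ_[p])) ^ l else 0)
        ((1 - X) ^ M * P) := by
  induction l generalizing M P with
  | zero =>
    obtain ⟨A, B, h⟩ := exists_one_sub_X_pow_eq (R := ℤ_[p]) (Fact.out : p.Prime) M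
    rw [h, add_mul, mul_assoc, mul_assoc, map_add, weightedCoeffSum_C_mul,
      weightedCoeffSum_X_pow_sub_one_mul, add_zero]
    · exact (PadicInt.factorial_dvd_pow M).mul_right _
    · intro j
      simp only [pow_zero]
      refine if_congr ?_ rfl rfl
      rw [Nat.cast_add, add_right_comm, dvd_add_self_right]
  | succ l ih =>
    set φ : ℕ → ℤ_[p] := fun j => if (p : ℤ) ∣ j + u then (((j + u : ℤ) : ℤ_[p])) ^ l else 0
      with hφ
    -- An extra factor $j+u$ in the weight acts on the polynomial as $X\,d/dX+u$. Differentiating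
    -- $(1-X)^{M+1}$ lowers the exponent but releases the factor $M+1$ lost from the factorial.
    have hsplit : (fun j : ℕ => if (p : ℤ) ∣ j + u then (((j + u : ℤ) : ℤ_[p])) ^ (l + 1) else 0)
        = fun j : ℕ => (j : ℤ_[p]) * φ j + (u : ℤ_[p]) * φ j := by
      funext j
      simp only [hφ]
      split_ifs
      · push_cast; ring
      · simp
    rw [hsplit, weightedCoeffSum_add, weightedCoeffSum_const_mul,
      ← weightedCoeffSum_X_mul_derivative]
    refine dvd_add ?_ ((ih M P).mul_left _)
    rcases M with _ | M
    · simp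
    have hder : X * derivative ((1 - X : ℤ_[p][X]) ^ (M + 1) * P) =
        C (((M + 1 : ℕ) : ℤ_[p])) * ((1 - X) ^ M * (-X * P)) +
          (1 - X) ^ (M + 1) * (X * derivative P) := by
      rw [derivative_mul, derivative_pow_succ]
      simp
      ring
    rw [hder, map_add, weightedCoeffSum_C_mul]
    refine dvd_add ?_ (ih _ _)
    rw [Nat.factorial_succ, Nat.cast_mul]
    exact mul_dvd_mul_left _ (ih _ _)

theorem factorial_dvd_weightedCoeffSum_eval (u : ℤ) (f : ℤ_[p][X]) (M : ℕ) (P : ℤ_[p][X]) :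
    ((M.factorial : ℕ) : ℤ_[p]) ∣
      weightedCoeffSum (fun j : ℕ => if (p : ℤ) ∣ j + u then f.eval (((j + u : ℤ) : ℤ_[p])) else 0)
        ((1 - X) ^ M * P) := by
  induction f using Polynomial.induction_on' with
  | add f g hf hg =>
    have : (fun j : ℕ => if (p : ℤ) ∣ j + u then (f + g).eval (((j + u : ℤ) : ℤ_[p])) else 0) =
        fun j : ℕ => (if (p : ℤ) ∣ j + u then f.eval (((j + u : ℤ) : ℤ_[p])) else 0) +
          (if (p : ℤ) ∣ j + u then g.eval (((j + u : ℤ) : ℤ_[p])) else 0) := by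
      funext j
      split_ifs <;> simp
    rw [this, weightedCoeffSum_add]
    exact dvd_add hf hg
  | monomial l a =>
    have : (fun j : ℕ => if (p : ℤ) ∣ j + u then
          (monomial l a).eval (((j + u : ℤ) : ℤ_[p])) else 0) =
        fun j : ℕ => a * (if (p : ℤ) ∣ j + u then (((j + u : ℤ) : ℤ_[p])) ^ l else 0) := by
      funext j
      split_ifs <;> simp
    rw [this, weightedCoeffSum_const_mul]
    exact (factorial_dvd_weightedCoeffSum_pow u l M P).mul_left _

/-- The divisibility for residue classes modulo `p * q`, in powers of `1 - X ^ q`. -/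
theorem factorial_dvd_weightedCoeffSum_expand {q : ℕ} (hq : 0 < q) (r : ℤ) (f : ℤ_[p][X])
    (M : ℕ) (P : ℤ_[p][X]) :
    ((M.factorial : ℕ) : ℤ_[p]) ∣
      weightedCoeffSum (fun k : ℕ => if (q * p : ℤ) ∣ k - r then
        f.eval ((((k - r) / q : ℤ) : ℤ_[p])) else 0) ((1 - X ^ q) ^ M * P) := by
  have hq' : (q : ℤ) ≠ 0 := by exact_mod_cast hq.ne'
  induction P using Polynomial.induction_on' with
  | add P Q hP hQ => rw [mul_add, map_add]; exact dvd_add hP hQ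
  | monomial t c =>
    have hE : ((1 - X ^ q) ^ M * monomial t c : ℤ_[p][X]) =
        C c * (X ^ t * expand ℤ_[p] q ((1 - X) ^ M)) := by
      rw [← C_mul_X_pow_eq_monomial]
      simp only [map_pow, map_sub, map_one, expand_X]
      ring
    rw [hE, weightedCoeffSum_C_mul, weightedCoeffSum_X_pow_mul, weightedCoeffSum_expand]
    refine Dvd.dvd.mul_left ?_ _
    -- Only exponents $k=jq+t$ occur, so either $t\equiv r$ mod $q$ and $(k-r)/q=j+u$, or every
    -- weight is zero.
    by_cases ht : (q : ℤ) ∣ t - r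
    · obtain ⟨u, hu⟩ := ht
      have key := factorial_dvd_weightedCoeffSum_eval u f M 1
      rw [mul_one] at key
      have hj : ∀ j : ℕ, ((j * q + t : ℕ) : ℤ) - r = q * (j + u) := fun j => by
        push_cast
        linear_combination hu
      simpa only [hj, mul_dvd_mul_iff_left hq', Int.mul_ediv_cancel_left _ hq'] using key
    · have hz : (fun j : ℕ => if (q * p : ℤ) ∣ ((j * q + t : ℕ) : ℤ) - r then
          f.eval (((((j * q + t : ℕ) : ℤ) - r) / q : ℤ) : ℤ_[p]) else 0) = fun _ => 0 := by
        funext j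
        refine if_neg fun h => ht ?_
        have h1 : (q : ℤ) ∣ ((j * q + t : ℕ) : ℤ) - r := (Dvd.intro _ rfl).trans h
        have h2 : (t : ℤ) - r = (((j * q + t : ℕ) : ℤ) - r) - q * j := by push_cast; ring
        rw [h2]
        exact dvd_sub h1 (Dvd.intro _ rfl)
      rw [hz, weightedCoeffSum_zero]
      simp

theorem coeff_one_sub_X_pow {R : Type*} [CommRing R] (n k : ℕ) :
    ((1 - X : R[X]) ^ n).coeff k = (-1) ^ k * (n.choose k : R) := by
  have h : (1 - X : R[X]) ^ n = ((1 + X) ^ n).comp (C (-1) * X) := by simp [sub_eq_add_neg]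
  rw [h, comp_C_mul_X_coeff, coeff_one_add_X_pow, mul_comm]

/-- An alternating binomial sum over a residue class modulo `p ^ (e + 1)`, weighted by an integral
polynomial in `(k - r) / p ^ e`, is divisible by `⌊n / p ^ e⌋!` in `ℤ_[p]`. -/
theorem factorial_dvd_sum_choose_mul_eval (e n : ℕ) (r : ℤ) (f : ℤ_[p][X]) :
    (((n / p ^ e).factorial : ℕ) : ℤ_[p]) ∣
      ∑ k ∈ Finset.range (n + 1), (if ((p : ℤ) ^ (e + 1)) ∣ k - r then
        (-1) ^ k * (n.choose k : ℤ_[p]) * f.eval ((((k - r) / (p : ℤ) ^ e : ℤ) : ℤ_[p])) else 0) := by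
  have hp : p.Prime := Fact.out
  set q := p ^ e with hq
  set N := n / q with hN
  have hq0 : 0 < q := pow_pos hp.pos e
  set φ : ℕ → ℤ_[p] := fun k => if (q * p : ℤ) ∣ k - r then
        f.eval ((((k - r) / q : ℤ) : ℤ_[p])) else 0 with hφ
  have hsum : ∑ k ∈ Finset.range (n + 1), (if ((p : ℤ) ^ (e + 1)) ∣ k - r then
        (-1) ^ k * (n.choose k : ℤ_[p]) * f.eval ((((k - r) / (p : ℤ) ^ e : ℤ) : ℤ_[p])) else 0)
      = weightedCoeffSum φ ((1 - X) ^ n) := by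
    rw [weightedCoeffSum_eq_sum_range φ _ (N := n + 1)]
    · refine Finset.sum_congr rfl fun k _ => ?_
      rw [coeff_one_sub_X_pow, hφ, hq, pow_succ]
      push_cast
      split_ifs <;> ring
    · refine Nat.lt_succ_of_le ((natDegree_pow_le).trans ?_)
      have : (1 - X : ℤ_[p][X]).natDegree ≤ 1 := by compute_degree
      simpa using Nat.mul_le_mul_left n this
  obtain ⟨g, hg⟩ := exists_add_pow_prime_pow_eq hp (1 - X : ℤ_[p][X]) X e
  have h1 : (1 - X : ℤ_[p][X]) ^ q = C (p : ℤ_[p]) * -((1 - X) * X * g) + (1 - X ^ q) := by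
    rw [sub_add_cancel, one_pow] at hg
    rw [map_natCast]
    linear_combination -hg
  have h2 : (1 - X : ℤ_[p][X]) ^ n = ∑ i ∈ Finset.range (N + 1),
      C ((p : ℤ_[p]) ^ i * (N.choose i : ℤ_[p])) *
        ((1 - X ^ q) ^ (N - i) * ((-((1 - X) * X * g)) ^ i * (1 - X) ^ (n % q))) := by
    conv_lhs => rw [← Nat.div_add_mod n q, pow_add, pow_mul, h1, add_pow, Finset.sum_mul]
    refine Finset.sum_congr rfl fun i _ => ?_
    simp only [C_mul, C_pow, map_natCast, mul_pow]
    ring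
  rw [hsum, h2, map_sum]
  refine Finset.dvd_sum fun i hi => ?_
  have hi' : i ≤ N := Nat.lt_succ_iff.1 (Finset.mem_range.1 hi)
  rw [weightedCoeffSum_C_mul]
  -- In $N!=\binom Ni\,i!\,(N-i)!$, the factor $i!$ divides $p^i$ and $(N-i)!$ divides the
  -- functional at the multiple of $(1-X^q)^{N-i}$.
  rw [← Nat.choose_mul_factorial_mul_factorial hi']
  push_cast
  refine mul_dvd_mul ?_ (factorial_dvd_weightedCoeffSum_expand hq0 r f (N - i) _)
  rw [mul_comm]
  exact mul_dvd_mul_right (PadicInt.factorial_dvd_pow_self i) _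

end Padic

/-! ### Coefficients of powers of $F=((1+X)^p-1-X^p)/p$ -/

section FreshmanQuotient

/-- The polynomial `((1 + X) ^ p - 1 - X ^ p) / p`. -/
noncomputable def freshmanQuotient (p : ℕ) : ℕ[X] :=
  ∑ s ∈ Finset.Ico 1 p, monomial s (p.choose s / p)

theorem coeff_freshmanQuotient (p s : ℕ) :
    (freshmanQuotient p).coeff s = if 1 ≤ s ∧ s < p then p.choose s / p else 0 := by
  simp [freshmanQuotient, finsetSum_coeff, coeff_monomial]

theorem natDegree_freshmanQuotient_le (p : ℕ) : (freshmanQuotient p).natDegree ≤ p - 1 := by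
  rw [natDegree_le_iff_coeff_eq_zero]
  intro s hs
  rw [coeff_freshmanQuotient, if_neg (by omega)]

theorem one_add_X_pow_prime {p : ℕ} (hp : p.Prime) :
    (1 + X : ℕ[X]) ^ p = (1 + X ^ p) + C p * freshmanQuotient p := by
  ext s
  rw [coeff_one_add_X_pow, coeff_add, coeff_add, coeff_one, coeff_X_pow, coeff_C_mul,
    coeff_freshmanQuotient, Nat.cast_id]
  rcases Nat.eq_zero_or_pos s with rfl | hs
  · simp [hp.ne_zero.symm]
  rcases lt_trichotomy s p with h | rfl | h
  · rw [if_neg hs.ne', if_neg h.ne, if_pos ⟨hs, h⟩,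
      Nat.mul_div_cancel' (hp.dvd_choose_self hs.ne' h)]
    simp
  · simp [hs.ne']
  · rw [Nat.choose_eq_zero_of_lt h, if_neg hs.ne', if_neg h.ne', if_neg (by omega)]
    simp

/-- $F$ has no constant term and degree below $p$, so the exponents in $F^i$ lie strictly between
$0$ and $pi$. In particular $i=1$ contributes nothing. -/
theorem coeff_freshmanQuotient_pow_eq_zero {p : ℕ} (hp : p.Prime) {i m : ℕ} (hi : 1 ≤ i)
    (hm : m = 0 ∨ i ≤ m) : (freshmanQuotient p ^ i).coeff (p * m) = 0 := by
  rcases hm with rfl | hm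
  · rw [mul_zero, coeff_zero_eq_eval_zero, eval_pow, ← coeff_zero_eq_eval_zero,
      coeff_freshmanQuotient, if_neg (by omega), zero_pow (by omega)]
  · refine coeff_eq_zero_of_natDegree_lt ?_
    calc (freshmanQuotient p ^ i).natDegree ≤ i * (p - 1) :=
          natDegree_pow_le_of_le i (natDegree_freshmanQuotient_le p)
      _ < i * p := Nat.mul_lt_mul_of_pos_left (Nat.sub_lt hp.pos one_pos) hi
      _ ≤ p * m := by rw [mul_comm]; exact Nat.mul_le_mul_left _ hm

variable (p : ℕ) [Fact p.Prime]

theorem ZMod.choose_pred_cast {k : ℕ} (hk : k < p) :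
    (((p - 1).choose k : ℕ) : ZMod p) = (-1) ^ k := by
  have hp : p.Prime := Fact.out
  induction k with
  | zero => simp
  | succ k ih =>
    have h1 : p.choose (k + 1) = (p - 1).choose k + (p - 1).choose (k + 1) := by
      conv_lhs => rw [← Nat.sub_add_cancel hp.one_le]
      exact Nat.choose_succ_succ _ _
    have h2 : ((p.choose (k + 1) : ℕ) : ZMod p) = 0 :=
      (ZMod.natCast_eq_zero_iff _ _).2 (hp.dvd_choose_self k.succ_ne_zero hk)
    rw [h1, Nat.cast_add, ih (by omega)] at h2
    rw [pow_succ]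
    linear_combination h2

/-- The base equals $\binom{p-1}{s-1}\equiv\pm1$; squaring removes the sign. -/
theorem ZMod.mul_choose_div_cast_sq {s : ℕ} (h0 : 1 ≤ s) (hs : s < p) :
    ((s : ZMod p) * ((p.choose s / p : ℕ) : ZMod p)) ^ 2 = 1 := by
  have hp : p.Prime := Fact.out
  obtain ⟨k, rfl⟩ := Nat.exists_eq_add_of_le' h0
  have h1 : (k + 1) * (p.choose (k + 1) / p) = (p - 1).choose k := by
    have h2 := Nat.add_one_mul_choose_eq (p - 1) k
    rw [Nat.sub_add_cancel hp.one_le] at h2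
    obtain ⟨c, hc⟩ := hp.dvd_choose_self k.succ_ne_zero hs
    rw [hc, Nat.mul_div_cancel_left _ hp.pos]
    rw [hc, mul_assoc] at h2
    rw [mul_comm, Nat.eq_of_mul_eq_mul_left hp.pos h2]
  rw [← Nat.cast_mul, h1, ZMod.choose_pred_cast p (by omega), ← pow_mul, mul_comm, pow_mul]
  simp

theorem ZMod.sum_range_natCast {M : Type*} [AddCommMonoid M] (f : ZMod p → M) :
    ∑ s ∈ Finset.range p, f s = ∑ x : ZMod p, f x :=
  Finset.sum_bij' (fun s _ => (s : ZMod p)) (fun x _ => x.val) (by simp)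
    (fun x _ => Finset.mem_range.2 x.val_lt)
    (fun s hs => ZMod.val_cast_of_lt (Finset.mem_range.1 hs)) (by simp) (by simp)

/-- A form of Wolstenholme's theorem. -/
theorem dvd_coeff_freshmanQuotient_sq (hp3 : 3 < p) : p ∣ (freshmanQuotient p ^ 2).coeff p := by
  have hp : p.Prime := Fact.out
  rw [← ZMod.natCast_eq_zero_iff, sq, coeff_mul, Finset.Nat.sum_antidiagonal_eq_sum_range_succ
    (fun i j => (freshmanQuotient p).coeff i * (freshmanQuotient p).coeff j),
    Finset.sum_range_succ, coeff_freshmanQuotient p p, if_neg (by omega), zero_mul, add_zero,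
    Nat.cast_sum]
  -- By symmetry the product is the square of the coefficient at $s$, hence $s^{-2}=s^{p-3}$ for
  -- $s\ne0$. At $s=0$ both sides vanish because $p>3$. The power sum is zero since $p-3<p-1$.
  have hterm : ∀ s ∈ Finset.range p, (((freshmanQuotient p).coeff s *
      (freshmanQuotient p).coeff (p - s) : ℕ) : ZMod p) = (s : ZMod p) ^ (p - 3) := by
    intro s hs
    have hs' := Finset.mem_range.1 hs
    rcases Nat.eq_zero_or_pos s with rfl | hs0
    · rw [coeff_freshmanQuotient, if_neg (by omega), Nat.cast_zero, zero_pow (by omega)]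
      simp
    · rw [coeff_freshmanQuotient, coeff_freshmanQuotient, if_pos (by omega), if_pos (by omega),
        Nat.choose_symm hs'.le]
      have hne : (s : ZMod p) ≠ 0 := by
        rw [Ne, ZMod.natCast_eq_zero_iff]
        exact Nat.not_dvd_of_pos_of_lt hs0 hs'
      have h1 := ZMod.mul_choose_div_cast_sq p hs0 hs'
      have h2 : (s : ZMod p) ^ (p - 3) * (s : ZMod p) ^ 2 = 1 := by
        rw [← pow_add, show p - 3 + 2 = p - 1 by omega]
        exact ZMod.pow_card_sub_one_eq_one hne
      refine mul_right_cancel₀ (pow_ne_zero 2 hne) ?_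
      rw [h2, ← h1]
      push_cast
      ring
  rw [Finset.sum_congr rfl hterm, ZMod.sum_range_natCast p (fun x => x ^ (p - 3))]
  refine FiniteField.sum_pow_lt_card_sub_one _ _ ?_
  rw [ZMod.card]
  omega

/-- This is where $a_p$ is determined. For $i\ge2$ the bound $i!\mid p^{\lfloor(i-1)/(p-1)\rfloor}$
suffices, except when $p>3$ and $i=2$, where it falls one power of $p$ short and Wolstenholme
supplies it. -/
theorem pow_sunExponent_mul_factorial_dvd {i : ℕ} (hi : 1 ≤ i) (m : ℕ) :
    (p : ℤ_[p]) ^ sunExponent p * ((i.factorial : ℕ) : ℤ_[p]) ∣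
      (p : ℤ_[p]) ^ i * (((freshmanQuotient p ^ i).coeff (p * m) : ℕ) : ℤ_[p]) := by
  have hp : p.Prime := Fact.out
  by_cases hm : m = 0 ∨ i ≤ m
  · rw [coeff_freshmanQuotient_pow_eq_zero hp hi hm]
    simp
  have hi2 : 2 ≤ i := by omega
  have hgen : ∀ a, a + (i - 1) / (p - 1) ≤ i →
      (p : ℤ_[p]) ^ a * ((i.factorial : ℕ) : ℤ_[p]) ∣
      (p : ℤ_[p]) ^ i * (((freshmanQuotient p ^ i).coeff (p * m) : ℕ) : ℤ_[p]) := by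
    intro a ha
    refine Dvd.dvd.mul_right ?_ _
    refine (mul_dvd_mul_left _ (PadicInt.factorial_dvd_pow i)).trans ?_
    rw [← pow_add]
    exact pow_dvd_pow _ ha
  unfold sunExponent
  split_ifs with h2 h3
  · subst h2
    exact hgen 1 (by omega)
  · subst h3
    exact hgen 2 (by omega)
  · have hp2 := hp.two_le
    -- Hence $p-1\ge4$, the denominator used for $i\ge3$ below.
    have hp4 : p ≠ 4 := by rintro rfl; norm_num at hp
    rcases hi2.eq_or_lt with rfl | hi3
    · have hm1 : m = 1 := by omega
      obtain ⟨c, hc⟩ := dvd_coeff_freshmanQuotient_sq p (by omega)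
      have htwo : ((Nat.factorial 2 : ℕ) : ℤ_[p]) ∣ 1 := by
        have := PadicInt.factorial_dvd_pow (p := p) 2
        rwa [Nat.div_eq_of_lt (by omega), pow_zero] at this
      rw [hm1, mul_one, hc, Nat.cast_mul, ← mul_assoc, ← pow_succ]
      exact mul_dvd_mul_left _ (htwo.trans (one_dvd _))
    · refine hgen 3 ?_
      have h4 : (i - 1) / (p - 1) ≤ (i - 1) / 4 := Nat.div_le_div_left (by omega) (by omega)
      omega

end FreshmanQuotient

/-! ### The quotient of $\binom{pn}{pk}$ by $\binom nk$ -/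

section BinomialQuotient

/-- Both sides are $n!/((k-m)!\,(n-k-(i-m))!)$, or zero when one of these factorials is undefined.
This extracts $\binom nk$ and leaves a polynomial in $k$. -/
theorem Nat.factorial_mul_choose_mul_choose {n k i m : ℕ} (hi : i ≤ n) (hk : k ≤ n)
    (hm : m ≤ i) : i.factorial * n.choose i * (if m ≤ k then (n - i).choose (k - m) else 0) =
      n.choose k * (k.descFactorial m * (n - k).descFactorial (i - m)) := by
  split_ifs with hmk
  · rcases Nat.lt_or_ge (n - i) (k - m) with h | h
    · rw [Nat.choose_eq_zero_of_lt h,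
        (Nat.descFactorial_eq_zero_iff_lt (n := n - k) (k := i - m)).2 (by omega)]
      simp
    · have h1 := Nat.choose_mul_factorial_mul_factorial hi
      have h2 := Nat.choose_mul_factorial_mul_factorial h
      have h3 := Nat.choose_mul_factorial_mul_factorial hk
      have h4 := Nat.factorial_mul_descFactorial hmk
      have h5 := Nat.factorial_mul_descFactorial (show i - m ≤ n - k by omega)
      rw [show n - i - (k - m) = n - k - (i - m) by omega] at h2
      have hpos : 0 < (k - m).factorial * (n - k - (i - m)).factorial :=
        Nat.mul_pos (Nat.factorial_pos _) (Nat.factorial_pos _)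
      refine Nat.eq_of_mul_eq_mul_right hpos ?_
      calc _ = n.choose i * i.factorial * ((n - i).choose (k - m) * (k - m).factorial *
            (n - k - (i - m)).factorial) := by ring
        _ = n.choose k * ((k - m).factorial * k.descFactorial m) *
            ((n - k - (i - m)).factorial * (n - k).descFactorial (i - m)) := by
          rw [h2, h1, h4, h5, h3]
        _ = _ := by ring
  · rw [Nat.descFactorial_eq_zero_iff_lt.2 (by omega)]
    simp

/-- At exponents divisible by $p$, only the part of $P$ in powers of $X^p$ meets `expand R p A`. -/
theorem coeff_expand_mul {R : Type*} [CommSemiring R] {p : ℕ} (hp : 0 < p) (A P : R[X]) {d : ℕ}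
    (hP : P.natDegree ≤ p * d) (k : ℕ) :
    (expand R p A * P).coeff (p * k) =
      ∑ m ∈ Finset.range (d + 1), P.coeff (p * m) * (if m ≤ k then A.coeff (k - m) else 0) := by
  rw [mul_comm, mul_comm p k, ← coeff_contract hp.ne', contract_mul_expand hp.ne' ]
  have hdeg : (contract p P).natDegree < d + 1 := by
    rw [Nat.lt_succ_iff, natDegree_le_iff_coeff_eq_zero]
    intro N hN
    rw [coeff_contract hp.ne']
    refine coeff_eq_zero_of_natDegree_lt (hP.trans_lt ?_)
    rw [mul_comm]
    exact Nat.mul_lt_mul_of_pos_right hN hp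
  conv_lhs => rw [(contract p P).as_sum_range' _ hdeg, Finset.sum_mul]
  rw [finsetSum_coeff]
  refine Finset.sum_congr rfl fun m _ => ?_
  rw [← C_mul_X_pow_eq_monomial, mul_assoc, coeff_C_mul, coeff_X_pow_mul', coeff_contract hp.ne',
    mul_comm m p]

theorem choose_mul_mul_eq_sum {p : ℕ} (hp : p.Prime) (n k : ℕ) :
    (p * n).choose (p * k) = ∑ i ∈ Finset.range (n + 1), p ^ i * (n.choose i *
      ((expand ℕ p ((1 + X) ^ (n - i))) * freshmanQuotient p ^ i).coeff (p * k)) := by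
  have h : ((1 + X : ℕ[X]) ^ (p * n)).coeff (p * k) = (p * n).choose (p * k) := by
    rw [coeff_one_add_X_pow, Nat.cast_id]
  rw [← h, pow_mul, one_add_X_pow_prime hp, add_comm, add_pow, finsetSum_coeff]
  refine Finset.sum_congr rfl fun i _ => ?_
  have : (C p * freshmanQuotient p) ^ i * (1 + X ^ p) ^ (n - i) * ((n.choose i : ℕ) : ℕ[X]) =
      C (p ^ i * n.choose i) * (expand ℕ p ((1 + X) ^ (n - i)) * freshmanQuotient p ^ i) := by
    simp only [map_pow, map_add, map_one, expand_X, C_mul, mul_pow, ← C_eq_natCast, Nat.cast_id]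
    ring
  rw [this, coeff_C_mul, mul_assoc]

theorem factorial_mul_choose_mul_coeff {p : ℕ} (hp : p.Prime) {n k i : ℕ} (hi : i ≤ n)
    (hk : k ≤ n) : i.factorial * (n.choose i *
      ((expand ℕ p ((1 + X) ^ (n - i))) * freshmanQuotient p ^ i).coeff (p * k)) =
    n.choose k * ∑ m ∈ Finset.range (i + 1), (freshmanQuotient p ^ i).coeff (p * m) *
      (k.descFactorial m * (n - k).descFactorial (i - m)) := by
  have hdeg : (freshmanQuotient p ^ i).natDegree ≤ p * i := by
    rw [mul_comm]
    exact (natDegree_pow_le_of_le i (natDegree_freshmanQuotient_le p)).trans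
      (Nat.mul_le_mul_left _ (Nat.sub_le _ _))
  rw [coeff_expand_mul hp.pos _ _ hdeg, ← mul_assoc, Finset.mul_sum, Finset.mul_sum]
  refine Finset.sum_congr rfl fun m hm => ?_
  rw [coeff_one_add_X_pow, Nat.cast_id, mul_left_comm,
    Nat.factorial_mul_choose_mul_choose hi hk (Nat.lt_succ_iff.1 (Finset.mem_range.1 hm)),
    mul_left_comm]

/-- The quotient of `(p * n).choose (p * k)` by `n.choose k` is `1` plus `p ^ a` times an integral
polynomial in `k`. -/
theorem exists_choose_mul_mul_eq (p : ℕ) [Fact p.Prime] (n : ℕ) :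
    ∃ Q : ℤ_[p][X], ∀ k ≤ n, (((p * n).choose (p * k) : ℕ) : ℤ_[p]) =
      n.choose k + (p : ℤ_[p]) ^ sunExponent p * (n.choose k * Q.eval (k : ℤ_[p])) := by
  have hp : p.Prime := Fact.out
  choose d hd using fun i m : ℕ => pow_sunExponent_mul_factorial_dvd p (Nat.le_add_left 1 i) m
  -- Here `i` stands for the exponent $i+1$ of $F$, since exponent $0$ gives the main term $\binom
  -- nk$. The integral `d i m` is $p^{i+1}[X^{pm}]F^{i+1}$ divided by $p^{a_p}(i+1)!$.
  refine ⟨∑ i ∈ Finset.range n, ∑ m ∈ Finset.range (i + 2), C (d i m) *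
    (descPochhammer ℤ_[p] m * (descPochhammer ℤ_[p] (i + 1 - m)).comp (C (n : ℤ_[p]) - X)),
    fun k hk => ?_⟩
  rw [choose_mul_mul_eq_sum hp, Finset.sum_range_succ', Nat.cast_add, add_comm]
  congr 1
  · have := factorial_mul_choose_mul_coeff hp (Nat.zero_le n) hk
    simp only [Nat.factorial_zero, one_mul] at this
    rw [this]
    simp
  · rw [Nat.cast_sum, eval_finsetSum, Finset.mul_sum, Finset.mul_sum]
    refine Finset.sum_congr rfl fun i hi => ?_
    have hfac : (((i + 1).factorial : ℕ) : ℤ_[p]) ≠ 0 := by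
      exact_mod_cast (i + 1).factorial_ne_zero
    refine mul_left_cancel₀ hfac ?_
    have h1 := congrArg (Nat.cast : ℕ → ℤ_[p])
      (factorial_mul_choose_mul_coeff hp (Finset.mem_range.1 hi : i + 1 ≤ n) hk)
    rw [Nat.cast_mul] at h1
    rw [Nat.cast_mul, mul_left_comm, h1]
    push_cast
    rw [eval_finsetSum, mul_left_comm, Finset.mul_sum, Finset.mul_sum, Finset.mul_sum,
      Finset.mul_sum, Finset.mul_sum]
    refine Finset.sum_congr rfl fun m _ => ?_
    have h2 := hd i m
    rw [eval_mul, eval_C, eval_mul, eval_comp, eval_sub, eval_C, eval_X, ← Nat.cast_sub hk,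
      descPochhammer_eval_eq_descFactorial, descPochhammer_eval_eq_descFactorial]
    linear_combination ((n.choose k : ℤ_[p]) * (k.descFactorial m : ℤ_[p]) *
      ((n - k).descFactorial (i + 1 - m) : ℤ_[p])) * h2

end BinomialQuotient

/-! ### Passage to rational numbers and conclusion -/

theorem cast_div_factorial_mul_sum (p : ℕ) [Fact p.Prime] (e l n N : ℕ) (r : ℤ) (b : ℕ → ℕ)
    {v : ℤ_[p]}
    (hv : ∑ k ∈ Finset.range (n + 1), (if ((p : ℤ) ^ (e + 1)) ∣ k - r then
      (-1) ^ k * (b k : ℤ_[p]) * ((((k - r) / (p : ℤ) ^ e : ℤ) : ℤ_[p])) ^ l else 0) =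
        ((N.factorial : ℕ) : ℤ_[p]) * v) :
    (v : ℚ_[p]) = ((1 / (N.factorial : ℚ) *
        ∑ k ∈ (Finset.range (n + 1)).filter (fun k : ℕ => (k : ℤ) ≡ r [ZMOD ((p : ℤ) ^ (e + 1))]),
          (-1 : ℚ) ^ k * (b k : ℚ) * (((k : ℚ) - (r : ℚ)) / (p : ℚ) ^ e) ^ l : ℚ) : ℚ_[p]) := by
  have hfac : ((N.factorial : ℕ) : ℚ_[p]) ≠ 0 := by exact_mod_cast N.factorial_ne_zero
  have hv' := congrArg (fun x : ℤ_[p] => (x : ℚ_[p])) hv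
  simp only [PadicInt.coe_mul, PadicInt.coe_natCast] at hv'
  rw [Rat.cast_mul, Rat.cast_div, Rat.cast_one, Rat.cast_natCast, one_div,
    eq_inv_mul_iff_mul_eq₀ hfac, ← hv', PadicInt.coe_sum, Rat.cast_sum, Finset.sum_filter]
  refine Finset.sum_congr rfl fun k _ => ?_
  have hiff : (k : ℤ) ≡ r [ZMOD ((p : ℤ) ^ (e + 1))] ↔ ((p : ℤ) ^ (e + 1)) ∣ k - r := by
    rw [Int.modEq_comm, Int.modEq_iff_dvd]
  simp only [hiff]
  split_ifs with h
  -- Since $p^e\mid k-r$, the integer division is exact and agrees with the rational one.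
  · obtain ⟨c, hc⟩ := (pow_dvd_pow (p : ℤ) e.le_succ).trans h
    have hpe : (p : ℤ) ^ e ≠ 0 := pow_ne_zero _ (by exact_mod_cast (Fact.out : p.Prime).ne_zero)
    have hc' : (k : ℚ) - (r : ℚ) = (p : ℚ) ^ e * c := by exact_mod_cast hc
    have hp0 : (p : ℚ) ^ e ≠ 0 := by exact_mod_cast hpe
    rw [hc, Int.mul_ediv_cancel_left _ hpe, hc', mul_div_cancel_left₀ _ hp0]
    push_cast
    rfl
  · exact Rat.cast_zero.symm

theorem theorem1p3 (p : ℕ) [Fact p.Prime] (α : ℕ) (hα : 1 ≤ α) (l n : ℕ) (r : ℤ) :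
    PadicModEq p (sunExponent p)
      (1 / ((n / p ^ (α - 1)).factorial : ℚ) *
        ∑ k ∈ (Finset.range (n + 1)).filter (fun k : ℕ => (k : ℤ) ≡ r [ZMOD ((p : ℤ) ^ α)]),
          (-1 : ℚ) ^ k * ((p * n).choose (p * k) : ℚ) *
            (((k : ℚ) - (r : ℚ)) / (p : ℚ) ^ (α - 1)) ^ l)
      (1 / ((n / p ^ (α - 1)).factorial : ℚ) *
        ∑ k ∈ (Finset.range (n + 1)).filter (fun k : ℕ => (k : ℤ) ≡ r [ZMOD ((p : ℤ) ^ α)]),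
          (-1 : ℚ) ^ k * (n.choose k : ℚ) *
            (((k : ℚ) - (r : ℚ)) / (p : ℚ) ^ (α - 1)) ^ l) := by
  obtain ⟨e, rfl⟩ := Nat.exists_eq_add_of_le' hα
  rw [Nat.add_sub_cancel]
  obtain ⟨Q, hQ⟩ := exists_choose_mul_mul_eq p n
  obtain ⟨v, hv⟩ := factorial_dvd_sum_choose_mul_eval (p := p) e n r (X ^ l)
  -- The inner substitution turns $(k-r)/p^e$ back into $k$, so this weight evaluates to
  -- $((k-r)/p^e)^l\,Q(k)$.
  obtain ⟨w, hw⟩ := factorial_dvd_sum_choose_mul_eval (p := p) e n r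
    (X ^ l * Q.comp (C (r : ℤ_[p]) + C ((p : ℤ_[p]) ^ e) * X))
  simp only [eval_pow, eval_X] at hv
  refine ⟨v + (p : ℤ_[p]) ^ sunExponent p * w, v,
    cast_div_factorial_mul_sum p e l n _ r (fun k => (p * n).choose (p * k)) ?_,
    cast_div_factorial_mul_sum p e l n _ r (fun k => n.choose k) hv, ?_⟩
  · rw [mul_add, mul_left_comm, ← hv, ← hw, Finset.mul_sum, ← Finset.sum_add_distrib]
    refine Finset.sum_congr rfl fun k hk => ?_
    split_ifs with h
    · have hk' : (r : ℤ_[p]) + (p : ℤ_[p]) ^ e * (((k - r) / (p : ℤ) ^ e : ℤ) : ℤ_[p]) = k := by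
        have h1 := Int.mul_ediv_cancel' ((pow_dvd_pow (p : ℤ) e.le_succ).trans h)
        have h2 := congrArg (Int.cast : ℤ → ℤ_[p]) h1
        push_cast at h2
        rw [h2]
        ring
      rw [hQ k (Nat.lt_succ_iff.1 (Finset.mem_range.1 hk)), eval_mul, eval_pow, eval_X, eval_comp,
        eval_add, eval_C, eval_mul, eval_C, eval_X, hk']
      ring
    · simp
  · rw [add_sub_cancel_left]
    exact dvd_mul_right _ _
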